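/- **Conventions.** All manifolds are smooth, connected, Hausdorff, paracompact, without boundary, and of the same finite dimension $n$. $(M,g)$ is a time-oriented Lorentzian manifold with metric of class $C^r$, $0\le r\le\infty$. Causal curves are piecewise $C^1$ with nonzero timelike or null velocity; $J^+(A)$ consists of $A$ and all endpoints of future-directed causal curves starting in $A$. **Abstract boundary.** An *envelopment* is a smooth embedding $\phi:M\to\widehat M$ into a manifold of the same dimension. A *boundary set* is a nonempty $B\subseteq\partial\phi(M)$, and a *boundary point* is a point of $\partial\phi(M)$. $B$ *covers* a boundary set $B'$ of an envelopment $\phi':M\to\widehat M'$ if for every neighbourhood $N$ of $B$ there is a neighbourhood $N'$ of $B'$ with $\phi\circ\phi'^{-1}(N'\cap\phi'(M))\subseteq N$; $B$ and $B'$ are equivalent if each covers the other. The *abstract boundary* $\mathcal B(M)$ is the set of equivalence classes that have a singleton representative. $B$ is *strongly attached* to $U\subseteq M$ if some open $N\supseteq B$ in $\widehat M$ has $N\cap\phi(M)\subseteq\phi(U)$; this depends only on the class of $B$. Let $\mathcal B_U\subseteq\mathcal B(M)$ be the set of classes strongly attached to $U$. The space $\overline M=M\sqcup\mathcal B(M)$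 carries the strongly attached point topology, with basis $\{U\cup\mathcal B_U : U\subseteq M \text{ open}\}$. **Singularities.** Let $\mathcal C$ be a family of $C^1$ parametrized curves $\gamma:[a,b)\to M$ ($a<b\le\infty$) with the *bounded parameter property*: every point of $M$ lies on some $\gamma\in\mathcal C$; restrictions of members to subintervals $[a',b')\subseteq[a,b)$ are members; and of two members related by an increasing $C^1$ change of parameter, either both or neither have $b<\infty$ ("bounded parameter"). A curve $\gamma\in\mathcal C$ *approaches* a boundary point $p$ if $p$ is a limit point of $\phi\circ\gamma$. A boundary point is a *point at infinity* if some $\gamma\in\mathcal C$ approaches it and every $\gamma\in\mathcal C$ approaching it has unbounded parameter; it is *singular* if some $\gamma\in\mathcal C$ with bounded parameter approaches it; it is a *pure singularity* if it is singular and covers no point at infinity of any envelopment. An element of $\mathcal B(M)$ is a pure singularity if it is the class of one. **Black region.** A *singular neighbourhood* is an open $U\subseteq M$ to which every pure singularity is strongly attached. A closed $A\subseteq M$ is *singularly compact* if $A\setminus U$ is compact for every singular neighbourhood $U$. The *black region* $\mathscr B\subseteq M$ is the union of all singularly compact $A$ with $J^+(A)=A$. **Proposition 5.7.** Let $\sigma:[0,b)\to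 M$, $0<b\le\infty$, be a future-directed causal curve that is inextendible ($\sigma(t)$ has no limit in $M$ as $t\to b$), meets $\mathscr B$, and is not partially imprisoned (that is, for every compact $K\subseteq M$ one has $\sigma(t)\notin K$ for all $t$ sufficiently close to $b$). Then for every sequence $(t_k)\subset[0,b)$ with $t_k\to b$, the sequence $(\sigma(t_k))$ has a pure singularity as an accumulation point in $\overline M$; that is, there is a pure singularity $s\in\mathcal B(M)$ each of whose neighbourhoods in $\overline M$ contains $\sigma(t_k)$ for infinitely many $k$. -/

import Mathlib

open Set Filter Topology
open scoped Manifold ContDiff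

universe u

noncomputable section

namespace ABoundary

/-! ## Lorentzian metrics, time orientations, causal curves -/

/-- A `C^r` Lorentzian metric on an `n`-manifold, with signature `(-,+,…,+)`: every tangent space
contains a vector with negative square on whose orthogonal complement the form is
positive definite. -/
structure LorentzMetric (n : ℕ) (r : ℕ∞) (M : Type*) [TopologicalSpace M]
    [ChartedSpace (EuclideanSpace ℝ (Fin n)) M] [IsManifold (𝓡 n) ∞ M] where
  form (x : M) : TangentSpace (𝓡 n) x →L[ℝ] TangentSpace (𝓡 n) x →L[ℝ] ℝ
  symm (x : M) (v w : TangentSpace (𝓡 n) x) : form x v w = form x w v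
  signature (x : M) : ∃ v : TangentSpace (𝓡 n) x, form x v v < 0 ∧
    ∀ w : TangentSpace (𝓡 n) x, form x v w = 0 → w ≠ 0 → 0 < form x w w
  contMDiff : ContMDiff (𝓡 n)
    ((𝓡 n).prod 𝓘(ℝ, EuclideanSpace ℝ (Fin n) →L[ℝ] EuclideanSpace ℝ (Fin n) →L[ℝ] ℝ)) r
    (fun x ↦ Bundle.TotalSpace.mk'
      (EuclideanSpace ℝ (Fin n) →L[ℝ] EuclideanSpace ℝ (Fin n) →L[ℝ] ℝ)
      (E := fun x : M ↦ TangentSpace (𝓡 n) x →L[ℝ] TangentSpace (𝓡 n) x →L[ℝ] ℝ) x (form x))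

/-- A time orientation, given by a continuous timelike vector field (declared to be
future-directed). -/
structure TimeOrientation {n : ℕ} {r : ℕ∞} {M : Type*} [TopologicalSpace M]
    [ChartedSpace (EuclideanSpace ℝ (Fin n)) M] [IsManifold (𝓡 n) ∞ M]
    (g : LorentzMetric n r M) where
  field (x : M) : TangentSpace (𝓡 n) x
  continuous_field : Continuous (fun x ↦ (⟨x, field x⟩ : TangentBundle (𝓡 n) M))
  timelike (x : M) : g.form x (field x) (field x) < 0

section Causality

variable {n : ℕ} {r : ℕ∞} {M : Type*} [TopologicalSpace M]
  [ChartedSpace (EuclideanSpace ℝ (Fin n)) M] [IsManifold (𝓡 n) ∞ M]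
  {g : LorentzMetric n r M}

/-- A tangent vector is future-directed causal: nonzero, timelike or null, and in the same
half-cone as the time orientation. -/
def TimeOrientation.IsFutureCausal (X : TimeOrientation g) {x : M}
    (v : TangentSpace (𝓡 n) x) : Prop :=
  v ≠ 0 ∧ g.form x v v ≤ 0 ∧ g.form x v (X.field x) < 0

/-- The velocity of `γ : ℝ → M` at `t`, relative to the parameter set `s` (so one-sided at the
endpoints of an interval). -/
def velocityWithin (n : ℕ) {M : Type*} [TopologicalSpace M]
    [ChartedSpace (EuclideanSpace ℝ (Fin n)) M] (γ : ℝ → M) (s : Set ℝ) (t : ℝ) :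
    TangentSpace (𝓡 n) (γ t) :=
  (mfderivWithin 𝓘(ℝ, ℝ) (𝓡 n) γ s t : ℝ →L[ℝ] TangentSpace (𝓡 n) (γ t)) 1

/-- `γ` restricts to a piecewise `C^1` future-directed causal curve on the compact interval
`[c, d]`: for a suitable finite set of break points, on every closed subinterval without break
points in its interior `γ` is `C^1` (up to the endpoints) with future-directed causal velocity. -/
def TimeOrientation.IsFutureCausalOn (X : TimeOrientation g) (γ : ℝ → M) (c d : ℝ) : Prop :=
  ∃ F : Finset ℝ, ∀ c' d' : ℝ, c ≤ c' → c' < d' → d' ≤ d → (∀ t ∈ Ioo c' d', t ∉ F) →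
    ContMDiffOn 𝓘(ℝ, ℝ) (𝓡 n) 1 γ (Icc c' d') ∧
      ∀ t ∈ Icc c' d', X.IsFutureCausal (velocityWithin n γ (Icc c' d') t)

/-- The causal future `J⁺(A)`: the points of `A` together with the endpoints of future-directed
causal curves that start in `A`. -/
def TimeOrientation.causalFuture (X : TimeOrientation g) (A : Set M) : Set M :=
  {q | q ∈ A ∨ ∃ (γ : ℝ → M) (c d : ℝ), c < d ∧ X.IsFutureCausalOn γ c d ∧ γ c ∈ A ∧ γ d = q}

end Causality

/-- The interval `[a, b)` of real parameters, where `b ≤ ∞`. -/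
def halfOpen (a : ℝ) (b : EReal) : Set ℝ := {t | a ≤ t ∧ (t : EReal) < b}

/-- The filter of real parameters approaching `b` from below, where `b ≤ ∞`. -/
def atEnd (b : EReal) : Filter ℝ := comap (fun t : ℝ ↦ (t : EReal)) (𝓝[<] b)

/-- `σ` is a (piecewise `C^1`) future-directed causal curve `[0, b) → M`; break points are
finite in number on every compact subinterval. Only the values of `σ` on `[0, b)` matter. -/
def TimeOrientation.IsFutureCausalCurve {n : ℕ} {r : ℕ∞} {M : Type*} [TopologicalSpace M]
    [ChartedSpace (EuclideanSpace ℝ (Fin n)) M] [IsManifold (𝓡 n) ∞ M]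
    {g : LorentzMetric n r M} (X : TimeOrientation g) (σ : ℝ → M) (b : EReal) : Prop :=
  ∀ d ∈ halfOpen 0 b, X.IsFutureCausalOn σ 0 d

/-- The curve `σ : [0, b) → M` is inextendible: it has no endpoint in `M`. -/
def IsInextendible {M : Type*} [TopologicalSpace M] (σ : ℝ → M) (b : EReal) : Prop :=
  ¬ ∃ p : M, Tendsto σ (atEnd b) (𝓝 p)

/-- The curve `σ : [0, b) → M` is partially imprisoned in some compact set: it meets that set at
parameters arbitrarily close to `b`. -/
def IsPartiallyImprisoned {M : Type*} [TopologicalSpace M] (σ : ℝ → M) (b : EReal) : Prop :=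
  ∃ K : Set M, IsCompact K ∧ ∃ᶠ t in atEnd b, σ t ∈ K

/-! ## The abstract boundary -/

/-- An envelopment of the `n`-manifold `M`: a smooth embedding into a (connected, Hausdorff,
paracompact, boundaryless) smooth manifold of the same dimension. -/
structure Envelopment (n : ℕ) (M : Type u) [TopologicalSpace M]
    [ChartedSpace (EuclideanSpace ℝ (Fin n)) M] where
  carrier : Type u
  [top : TopologicalSpace carrier]
  [charted : ChartedSpace (EuclideanSpace ℝ (Fin n)) carrier]
  [smooth : IsManifold (𝓡 n) ∞ carrier]
  [connected : ConnectedSpace carrier]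
  [t2 : T2Space carrier]
  [paracompact : ParacompactSpace carrier]
  map : M → carrier
  isSmoothEmbedding : Manifold.IsSmoothEmbedding (𝓡 n) (𝓡 n) ∞ map

attribute [instance] Envelopment.top Envelopment.charted Envelopment.smooth
  Envelopment.connected Envelopment.t2 Envelopment.paracompact

/-- A boundary set: a nonempty subset of the topological boundary of `φ(M)`, for some
envelopment `φ`. -/
structure BoundarySet (n : ℕ) (M : Type u) [TopologicalSpace M]
    [ChartedSpace (EuclideanSpace ℝ (Fin n)) M] where
  env : Envelopment n M
  set : Set env.carrier
  nonempty : set.Nonempty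
  subset_frontier : set ⊆ frontier (range env.map)

/-- A boundary point of some envelopment. -/
structure BoundaryPoint (n : ℕ) (M : Type u) [TopologicalSpace M]
    [ChartedSpace (EuclideanSpace ℝ (Fin n)) M] where
  env : Envelopment n M
  point : env.carrier
  mem_frontier : point ∈ frontier (range env.map)

section Boundary

variable {n : ℕ} {M : Type u} [TopologicalSpace M] [ChartedSpace (EuclideanSpace ℝ (Fin n)) M]

/-- The singleton boundary set of a boundary point. -/
def BoundaryPoint.toSet (p : BoundaryPoint n M) : BoundarySet n M where
  env := p.env
  set := {p.point}
  nonempty := singleton_nonempty _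
  subset_frontier := singleton_subset_iff.2 p.mem_frontier

/-- `B` covers `B'`: for every neighbourhood `N` of `B` there is a neighbourhood `N'` of `B'` with
`φ ∘ φ'⁻¹ (N' ∩ φ'(M)) ⊆ N`. -/
def BoundarySet.Covers (B B' : BoundarySet n M) : Prop :=
  ∀ N ∈ 𝓝ˢ B.set, ∃ N' ∈ 𝓝ˢ B'.set, ∀ x : M, B'.env.map x ∈ N' → B.env.map x ∈ N

theorem BoundarySet.Covers.refl (B : BoundarySet n M) : B.Covers B :=
  fun N hN ↦ ⟨N, hN, fun _ h ↦ h⟩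

theorem BoundarySet.Covers.trans {B₁ B₂ B₃ : BoundarySet n M} (h₁₂ : B₁.Covers B₂)
    (h₂₃ : B₂.Covers B₃) : B₁.Covers B₃ := by
  intro N hN
  obtain ⟨N', hN', h'⟩ := h₁₂ N hN
  obtain ⟨N'', hN'', h''⟩ := h₂₃ N' hN'
  exact ⟨N'', hN'', fun x hx ↦ h' x (h'' x hx)⟩

variable (n M) in
/-- Boundary sets are equivalent if each covers the other. -/
def boundarySetoid : Setoid (BoundarySet n M) where
  r B B' := B.Covers B' ∧ B'.Covers B
  iseqv :=
    { refl := fun B ↦ ⟨.refl B, .refl B⟩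
      symm := fun h ↦ ⟨h.2, h.1⟩
      trans := fun h h' ↦ ⟨h.1.trans h'.1, h'.2.trans h.2⟩ }

variable (n M) in
/-- Abstract boundary sets: equivalence classes of boundary sets. -/
def AbstractBoundarySet : Type (u + 1) := Quotient (boundarySetoid n M)

/-- The class `[p]` of a boundary point `p`. -/
def BoundaryPoint.cls (p : BoundaryPoint n M) : AbstractBoundarySet n M :=
  Quotient.mk (boundarySetoid n M) p.toSet

variable (n M) in
/-- The abstract boundary `𝓑(M)`: the abstract boundary sets with a singleton representative. -/
def AbstractBoundary : Type (u + 1) :=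
  {c : AbstractBoundarySet n M // ∃ p : BoundaryPoint n M, p.cls = c}

/-- The boundary set `B` is strongly attached to `U ⊆ M`: some open `N ⊇ B` in the enveloping
manifold has `N ∩ φ(M) ⊆ φ(U)`. -/
def BoundarySet.StronglyAttached (B : BoundarySet n M) (U : Set M) : Prop :=
  ∃ N : Set B.env.carrier, IsOpen N ∧ B.set ⊆ N ∧ N ∩ range B.env.map ⊆ B.env.map '' U

theorem BoundarySet.StronglyAttached.of_covers {B B' : BoundarySet n M} {U : Set M}
    (h : B.StronglyAttached U) (hc : B.Covers B') : B'.StronglyAttached U := by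
  obtain ⟨N, hN, hBN, hNU⟩ := h
  obtain ⟨N', hN', hsub⟩ := hc N (hN.mem_nhdsSet.2 hBN)
  refine ⟨interior N', isOpen_interior, subset_interior_iff_mem_nhdsSet.2 hN', ?_⟩
  rintro _ ⟨hx, x, rfl⟩
  obtain ⟨y, hy, hyx⟩ := hNU ⟨hsub x (interior_subset hx), mem_range_self x⟩
  exact ⟨x, B.env.isSmoothEmbedding.isEmbedding.injective hyx ▸ hy, rfl⟩

/-- Strong attachment of an abstract boundary set; it does not depend on the representative. -/
def AbstractBoundarySet.StronglyAttached (c : AbstractBoundarySet n M) (U : Set M) : Prop :=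
  Quotient.liftOn c (fun B : BoundarySet n M ↦ B.StronglyAttached U)
    fun _ _ h ↦ propext ⟨fun h' ↦ h'.of_covers h.1, fun h' ↦ h'.of_covers h.2⟩

variable (n M) in
/-- The space `M̄ = M ∪ 𝓑(M)` (a disjoint union). -/
inductive Completion : Type (u + 1)
  | pt : M → Completion
  | bdry : AbstractBoundary n M → Completion

/-- The basic set `U ∪ 𝓑_U` of `M̄`. -/
def Completion.basic (U : Set M) : Set (Completion n M) :=
  Completion.pt '' U ∪ Completion.bdry '' {s | s.1.StronglyAttached U}

/-- The strongly attached point topology, generated by the sets `U ∪ 𝓑_U` with `U ⊆ M` open. -/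
instance Completion.instTopologicalSpace : TopologicalSpace (Completion n M) :=
  TopologicalSpace.generateFrom {W | ∃ U : Set M, IsOpen U ∧ W = Completion.basic U}

end Boundary

/-! ## Curve families and the classification of boundary points -/

/-- A `C^1` parametrized curve `[a, b) → M` with `a < b ≤ ∞`. Only the values of the underlying
function on `[a, b)` matter. -/
structure ParamCurve (n : ℕ) (M : Type*) [TopologicalSpace M]
    [ChartedSpace (EuclideanSpace ℝ (Fin n)) M] where
  toFun : ℝ → M
  a : ℝ
  b : EReal
  a_lt_b : (a : EReal) < b
  contMDiffOn : ContMDiffOn 𝓘(ℝ, ℝ) (𝓡 n) 1 toFun (halfOpen a b)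

section Families

variable {n : ℕ} {M : Type u} [TopologicalSpace M] [ChartedSpace (EuclideanSpace ℝ (Fin n)) M]

/-- The parameter interval `[a, b)`. -/
def ParamCurve.dom (γ : ParamCurve n M) : Set ℝ := halfOpen γ.a γ.b

/-- `b < ∞`. -/
def ParamCurve.Bounded (γ : ParamCurve n M) : Prop := γ.b < ⊤

/-- `δ` is the restriction of `γ` to a subinterval `[a', b') ⊆ [a, b)`. -/
def ParamCurve.IsSubcurve (δ γ : ParamCurve n M) : Prop :=
  γ.a ≤ δ.a ∧ δ.b ≤ γ.b ∧ EqOn δ.toFun γ.toFun δ.dom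

/-- `δ` arises from `γ` by an increasing change of parameter. -/
def ParamCurve.IsReparam (δ γ : ParamCurve n M) : Prop :=
  ∃ s : ℝ → ℝ, StrictMonoOn s δ.dom ∧ ContDiffOn ℝ 1 s δ.dom ∧ s '' δ.dom = γ.dom ∧
    EqOn δ.toFun (γ.toFun ∘ s) δ.dom

/-- The bounded parameter property of a family of curves. -/
structure BoundedParameterProperty (C : Set (ParamCurve n M)) : Prop where
  through (p : M) : ∃ γ ∈ C, ∃ t ∈ γ.dom, γ.toFun t = p
  subcurve {γ δ : ParamCurve n M} (hγ : γ ∈ C) (h : δ.IsSubcurve γ) : δ ∈ C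
  reparam {γ δ : ParamCurve n M} (hγ : γ ∈ C) (hδ : δ ∈ C) (h : δ.IsReparam γ) :
    δ.Bounded ↔ γ.Bounded

/-- `γ` approaches the boundary point `p`: `p` is a limit point of `φ ∘ γ`. -/
def BoundaryPoint.ApproachedBy (p : BoundaryPoint n M) (γ : ParamCurve n M) : Prop :=
  ∃ t : ℕ → ℝ, (∀ k, t k ∈ γ.dom) ∧ Tendsto (fun k ↦ (t k : EReal)) atTop (𝓝 γ.b) ∧
    Tendsto (fun k ↦ p.env.map (γ.toFun (t k))) atTop (𝓝 p.point)

/-- A point at infinity: approachable, and only by curves with unbounded parameter. -/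
def BoundaryPoint.IsPointAtInfinity (C : Set (ParamCurve n M)) (p : BoundaryPoint n M) : Prop :=
  (∃ γ ∈ C, p.ApproachedBy γ) ∧ ∀ γ ∈ C, p.ApproachedBy γ → ¬ γ.Bounded

/-- A singular boundary point: approached by some curve with bounded parameter. -/
def BoundaryPoint.IsSingular (C : Set (ParamCurve n M)) (p : BoundaryPoint n M) : Prop :=
  ∃ γ ∈ C, p.ApproachedBy γ ∧ γ.Bounded

/-- A pure singularity: a singular boundary point that covers no point at infinity (of any
envelopment). -/
def BoundaryPoint.IsPureSingularity (C : Set (ParamCurve n M)) (p : BoundaryPoint n M) : Prop :=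
  p.IsSingular C ∧ ¬ ∃ q : BoundaryPoint n M, q.IsPointAtInfinity C ∧ p.toSet.Covers q.toSet

/-- An abstract boundary point is a pure singularity if a boundary point representing it is. -/
def AbstractBoundary.IsPureSingularity (C : Set (ParamCurve n M))
    (s : AbstractBoundary n M) : Prop :=
  ∃ p : BoundaryPoint n M, p.cls = s.1 ∧ p.IsPureSingularity C

/-! ## Singular neighbourhoods and the black region -/

/-- A singular neighbourhood: an open set to which every pure singularity is strongly attached. -/
def IsSingularNeighborhood (C : Set (ParamCurve n M)) (U : Set M) : Prop :=
  IsOpen U ∧ ∀ s : AbstractBoundary n M, s.IsPureSingularity C → s.1.StronglyAttached U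

/-- A singularly compact set: closed, and compact after removal of any singular neighbourhood. -/
def IsSingularlyCompact (C : Set (ParamCurve n M)) (A : Set M) : Prop :=
  IsClosed A ∧ ∀ U : Set M, IsSingularNeighborhood C U → IsCompact (A \ U)

/-- The black region: the union of all singularly compact sets `A` with `J⁺(A) = A`. -/
def blackRegion [IsManifold (𝓡 n) ∞ M] {r : ℕ∞} {g : LorentzMetric n r M}
    (X : TimeOrientation g) (C : Set (ParamCurve n M)) : Set M :=
  ⋃₀ {A | IsSingularlyCompact C A ∧ X.causalFuture A = A}

end Families

end ABoundary

end

namespace ABoundary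

/-! The proof is by contradiction. If no pure singularity is an accumulation point of `σ (t k)`,
each one is strongly attached to an open set missing a tail of the sequence. Deleting the finitely
many earlier terms preserves strong attachment: `φ(M)` is open by equality of dimensions, so
boundary points lie outside it and are separated from finite subsets of it. The union of the
resulting sets, one per pure singularity, is a singular neighbourhood `U` missing the whole sequence
(`exists_isSingularNeighborhood_forall_notMem`).

The curve meets a singularly compact `A` with `J⁺(A) = A`, and hence remains in `A` from then on. So
`A \ U` is compact and contains `σ (t k)` for all large `k`, which makes `σ` partially imprisoned.
-/

/-- An immersion between manifolds modelled on the same finite-dimensional space has open range. -/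
theorem isOpen_range_of_isImmersion {n : ℕ} {k : WithTop ℕ∞} {M N : Type*}
    [TopologicalSpace M] [ChartedSpace (EuclideanSpace ℝ (Fin n)) M]
    [TopologicalSpace N] [ChartedSpace (EuclideanSpace ℝ (Fin n)) N] {f : M → N}
    (hf : Manifold.IsImmersion (𝓡 n) (𝓡 n) k f) : IsOpen (range f) := by
  rw [isOpen_iff_mem_nhds]
  rintro _ ⟨x, rfl⟩
  have h := hf.isImmersionAt x
  -- In suitable charts an immersion is `u ↦ h.equiv (u, 0)`. This is an injective linear map
  -- between spaces of equal dimension, hence surjective and open.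
  let L : EuclideanSpace ℝ (Fin n) →ₗ[ℝ] EuclideanSpace ℝ (Fin n) :=
    h.equiv.toLinearMap ∘ₗ LinearMap.inl ℝ _ _
  have hL : Function.Injective L := h.equiv.injective.comp (Prod.mk_left_injective 0)
  have hLopen : IsOpenMap L :=
    (L.toContinuousLinearMap).isOpenMap (LinearMap.injective_iff_surjective.1 hL)
  have hsrc : x ∈ (h.domChart.extend (𝓡 n)).source := by
    simpa using h.mem_domChart_source
  have hfsrc : f x ∈ h.codChart.source := h.mem_codChart_source
  have hO : IsOpen (L '' (h.domChart.extend (𝓡 n)).target) :=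
    hLopen _ (h.domChart.isOpen_extend_target)
  have hchart : ∀ u ∈ (h.domChart.extend (𝓡 n)).target,
      h.codChart.extend (𝓡 n) (f ((h.domChart.extend (𝓡 n)).symm u)) = L u :=
    fun u hu ↦ h.writtenInCharts hu
  have hx : h.codChart.extend (𝓡 n) (f x) ∈ L '' (h.domChart.extend (𝓡 n)).target := by
    refine ⟨_, (h.domChart.extend (𝓡 n)).map_source hsrc, ?_⟩
    rw [← hchart _ ((h.domChart.extend (𝓡 n)).map_source hsrc),
      (h.domChart.extend (𝓡 n)).left_inv hsrc]
  -- A point `y` near `f x` has chart value `L u`, which is also the chart value of the image of the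
  -- point with coordinate `u`. Injectivity of the chart identifies the two.
  filter_upwards [h.codChart.open_source.mem_nhds hfsrc,
    (h.codChart.continuousAt_extend (I := 𝓡 n) hfsrc).preimage_mem_nhds (hO.mem_nhds hx)]
    with y hy ⟨u, hu, huy⟩
  refine ⟨(h.domChart.extend (𝓡 n)).symm u, ?_⟩
  have hu' : (h.domChart.extend (𝓡 n)).symm u ∈ h.domChart.source := by
    simpa using (h.domChart.extend (𝓡 n)).map_target hu
  refine (h.codChart.extend (𝓡 n)).injOn ?_ ?_ ((hchart u hu).trans huy)
  · simpa using h.source_subset_preimage_source hu'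
  · simpa using hy

/-! ### Strong attachment and the topology of `M̄`. -/

section Boundary

variable {n : ℕ} {M : Type*} [TopologicalSpace M] [ChartedSpace (EuclideanSpace ℝ (Fin n)) M]

/-- The frontier of an open set is disjoint from it, and `φ(M)` is open. -/
theorem BoundarySet.notMem_range (B : BoundarySet n M) {y : B.env.carrier} (hy : y ∈ B.set) :
    y ∉ range B.env.map := by
  have h := B.subset_frontier hy
  rw [(isOpen_range_of_isImmersion B.env.isSmoothEmbedding.isImmersion).frontier_eq] at h
  exact h.2

theorem BoundarySet.StronglyAttached.mono {B : BoundarySet n M} {U V : Set M}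
    (h : B.StronglyAttached U) (hUV : U ⊆ V) : B.StronglyAttached V := by
  obtain ⟨N, hN, hBN, hNU⟩ := h
  exact ⟨N, hN, hBN, hNU.trans (image_mono hUV)⟩

theorem BoundarySet.StronglyAttached.inter {B : BoundarySet n M} {U V : Set M}
    (hU : B.StronglyAttached U) (hV : B.StronglyAttached V) : B.StronglyAttached (U ∩ V) := by
  obtain ⟨N, hN, hBN, hNU⟩ := hU
  obtain ⟨N', hN', hBN', hNV⟩ := hV
  refine ⟨N ∩ N', hN.inter hN', subset_inter hBN hBN', ?_⟩
  rw [image_inter B.env.isSmoothEmbedding.isEmbedding.injective]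
  exact fun y hy ↦ ⟨hNU ⟨hy.1.1, hy.2⟩, hNV ⟨hy.1.2, hy.2⟩⟩

theorem BoundarySet.stronglyAttached_univ (B : BoundarySet n M) : B.StronglyAttached univ :=
  ⟨univ, isOpen_univ, subset_univ _, by simp⟩

/-- A boundary set is strongly attached to the complement of any finite subset of `M`. -/
theorem BoundarySet.stronglyAttached_compl_finite (B : BoundarySet n M) {F : Set M}
    (hF : F.Finite) : B.StronglyAttached Fᶜ := by
  -- The image of `F` is finite, so closed in the Hausdorff envelopment, and it lies in `φ(M)`, away
  -- from `B`.
  refine ⟨(B.env.map '' F)ᶜ, (hF.image _).isClosed.isOpen_compl, ?_, ?_⟩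
  · intro y hy hyF
    exact B.notMem_range hy (image_subset_range _ _ hyF)
  · rintro _ ⟨hx, x, rfl⟩
    exact ⟨x, fun hxF ↦ hx ⟨x, hxF, rfl⟩, rfl⟩

theorem AbstractBoundarySet.StronglyAttached.mono {c : AbstractBoundarySet n M} {U V : Set M}
    (h : c.StronglyAttached U) (hUV : U ⊆ V) : c.StronglyAttached V := by
  induction c using Quotient.inductionOn with
  | h B => exact BoundarySet.StronglyAttached.mono h hUV

theorem AbstractBoundarySet.StronglyAttached.inter {c : AbstractBoundarySet n M} {U V : Set M}
    (hU : c.StronglyAttached U) (hV : c.StronglyAttached V) : c.StronglyAttached (U ∩ V) := by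
  induction c using Quotient.inductionOn with
  | h B => exact BoundarySet.StronglyAttached.inter hU hV

theorem AbstractBoundarySet.stronglyAttached_univ (c : AbstractBoundarySet n M) :
    c.StronglyAttached univ := by
  induction c using Quotient.inductionOn with
  | h B => exact B.stronglyAttached_univ

theorem AbstractBoundarySet.StronglyAttached.diff_finite {c : AbstractBoundarySet n M}
    {U F : Set M} (h : c.StronglyAttached U) (hF : F.Finite) : c.StronglyAttached (U \ F) := by
  induction c using Quotient.inductionOn with
  | h B => exact BoundarySet.StronglyAttached.inter h (B.stronglyAttached_compl_finite hF)

/-- Intersecting two attaching neighbourhoods shows that attachment to `U` and to `V` gives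
attachment to `U ∩ V`. The generating family is therefore a basis, and neighbourhoods of a boundary
point can be tested on single sets `U ∪ 𝓑_U`. -/
theorem Completion.isTopologicalBasis_basic :
    TopologicalSpace.IsTopologicalBasis
      {W : Set (Completion n M) | ∃ U : Set M, IsOpen U ∧ W = Completion.basic U} where
  exists_subset_inter := by
    rintro _ ⟨U, hU, rfl⟩ _ ⟨V, hV, rfl⟩ x hx
    refine ⟨_, ⟨U ∩ V, hU.inter hV, rfl⟩, ?_, subset_inter ?_ ?_⟩
    · rcases x with x | s
      · simpa [Completion.basic] using hx
      · have hs : s.1.StronglyAttached U ∧ s.1.StronglyAttached V := by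
          simpa [Completion.basic] using hx
        simpa [Completion.basic] using hs.1.inter hs.2
    · exact union_subset_union (image_mono inter_subset_left)
        (image_mono fun s hs ↦ AbstractBoundarySet.StronglyAttached.mono hs inter_subset_left)
    · exact union_subset_union (image_mono inter_subset_right)
        (image_mono fun s hs ↦ AbstractBoundarySet.StronglyAttached.mono hs inter_subset_right)
  sUnion_eq := by
    refine eq_univ_of_forall fun x ↦ ⟨_, ⟨univ, isOpen_univ, rfl⟩, ?_⟩
    rcases x with x | s
    · simp [Completion.basic]
    · simpa [Completion.basic] using s.1.stronglyAttached_univ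
  eq_generateFrom := rfl

/-- If an abstract boundary point is not a cluster point of a sequence in `M`, it is strongly
attached to an open set that contains no term of the sequence. -/
theorem AbstractBoundary.exists_stronglyAttached_forall_notMem [T1Space M]
    {s : AbstractBoundary n M} {x : ℕ → M}
    (h : ¬ MapClusterPt (Completion.bdry s) atTop fun k ↦ (Completion.pt (x k) : Completion n M)) :
    ∃ U : Set M, IsOpen U ∧ s.1.StronglyAttached U ∧ ∀ k, x k ∉ U := by
  rw [mapClusterPt_iff_frequently] at h
  push Not at h
  obtain ⟨W, hW, hxW⟩ := h
  obtain ⟨_, ⟨U, hU, rfl⟩, hs, hUW⟩ :=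
    Completion.isTopologicalBasis_basic.mem_nhds_iff.1 hW
  have hs' : s.1.StronglyAttached U := by simpa [Completion.basic] using hs
  obtain ⟨m, hm⟩ := eventually_atTop.1 hxW
  have hfin : (x '' Iio m).Finite := (finite_Iio m).image x
  -- `U` already avoids all terms from index `m` on; the finitely many earlier ones are removed by
  -- hand.
  refine ⟨U \ x '' Iio m, hU.sdiff hfin.isClosed, hs'.diff_finite hfin, fun k hk ↦ ?_⟩
  rcases lt_or_ge k m with hkm | hkm
  · exact hk.2 ⟨k, hkm, rfl⟩
  · exact hm k hkm (hUW (Or.inl ⟨_, hk.1, rfl⟩))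

/-- A sequence none of whose cluster points is a pure singularity avoids some singular
neighbourhood. -/
theorem exists_isSingularNeighborhood_forall_notMem [T1Space M] {C : Set (ParamCurve n M)}
    {x : ℕ → M} (h : ∀ s : AbstractBoundary n M, s.IsPureSingularity C →
      ¬ MapClusterPt (Completion.bdry s) atTop fun k ↦ (Completion.pt (x k) : Completion n M)) :
    ∃ U : Set M, IsSingularNeighborhood C U ∧ ∀ k, x k ∉ U := by
  choose! U hUo hUs hUx using fun s hs ↦
    AbstractBoundary.exists_stronglyAttached_forall_notMem (h s hs)
  -- Attachment passes to larger sets, so an arbitrary union works. It is empty if there are no pure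
  -- singularities.
  refine ⟨⋃ (s) (_ : s.IsPureSingularity C), U s,
    ⟨isOpen_biUnion hUo, fun s hs ↦ (hUs s hs).mono (subset_biUnion_of_mem (u := U) hs)⟩, ?_⟩
  simpa using fun k s hs ↦ hUx s hs k

end Boundary

/-! ### Causal curves and future sets. -/

section Causality

variable {n : ℕ} {r : ℕ∞} {M : Type*} [TopologicalSpace M]
  [ChartedSpace (EuclideanSpace ℝ (Fin n)) M] [IsManifold (𝓡 n) ∞ M]
  {g : LorentzMetric n r M} {X : TimeOrientation g}

theorem TimeOrientation.IsFutureCausalOn.mono_left {γ : ℝ → M} {c c' d : ℝ}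
    (h : X.IsFutureCausalOn γ c d) (hc : c ≤ c') : X.IsFutureCausalOn γ c' d := by
  obtain ⟨F, hF⟩ := h
  exact ⟨F, fun p q hp ↦ hF p q (hc.trans hp)⟩

/-- A future-directed causal curve stays in every future set that it meets. -/
theorem TimeOrientation.IsFutureCausalCurve.mem_of_causalFuture_eq {σ : ℝ → M} {b : EReal}
    (hσ : X.IsFutureCausalCurve σ b) {A : Set M} (hA : X.causalFuture A = A) {t₀ t : ℝ}
    (ht₀ : t₀ ∈ halfOpen 0 b) (h₀ : σ t₀ ∈ A) (ht : t ∈ halfOpen 0 b) (hle : t₀ ≤ t) :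
    σ t ∈ A := by
  -- Causal curves in `causalFuture` need a nondegenerate interval, so equal parameters are treated
  -- apart.
  rcases hle.eq_or_lt with rfl | hlt
  · exact h₀
  · rw [← hA]
    exact Or.inr ⟨σ, t₀, t, hlt, (hσ t ht).mono_left ht₀.1, h₀, rfl⟩

end Causality

/-- `atEnd b` comes from the punctured left neighbourhoods of `b`, hence the strict bound on every
term. -/
theorem tendsto_atEnd {b : EReal} {t : ℕ → ℝ} (ht : ∀ k, (t k : EReal) < b)
    (htend : Tendsto (fun k ↦ (t k : EReal)) atTop (𝓝 b)) : Tendsto t atTop (atEnd b) :=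
  tendsto_comap_iff.2 (tendsto_nhdsWithin_iff.2 ⟨htend, .of_forall ht⟩)

end ABoundary

theorem proposition5p7 {n : ℕ} {r : ℕ∞} {M : Type u} [TopologicalSpace M]
    [ChartedSpace (EuclideanSpace ℝ (Fin n)) M] [IsManifold (𝓡 n) ∞ M]
    [ConnectedSpace M] [T2Space M] [ParacompactSpace M]
    (g : ABoundary.LorentzMetric n r M) (X : ABoundary.TimeOrientation g)
    (C : Set (ABoundary.ParamCurve n M)) (hC : ABoundary.BoundedParameterProperty C)
    (b : EReal) (hb : 0 < b) (σ : ℝ → M)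
    (hσ : X.IsFutureCausalCurve σ b)
    (hinext : ABoundary.IsInextendible σ b)
    (hmeets : ∃ t ∈ ABoundary.halfOpen 0 b, σ t ∈ ABoundary.blackRegion X C)
    (himp : ¬ ABoundary.IsPartiallyImprisoned σ b)
    (t : ℕ → ℝ) (ht : ∀ k, t k ∈ ABoundary.halfOpen 0 b)
    (htend : Tendsto (fun k ↦ (t k : EReal)) atTop (𝓝 b)) :
    ∃ s : ABoundary.AbstractBoundary n M, s.IsPureSingularity C ∧
      MapClusterPt (ABoundary.Completion.bdry s) atTop
        (fun k ↦ (ABoundary.Completion.pt (σ (t k)) : ABoundary.Completion n M)) := by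
  by_contra! hcon
  obtain ⟨U, hU, hUσ⟩ := ABoundary.exists_isSingularNeighborhood_forall_notMem hcon
  obtain ⟨t₀, ht₀, A, ⟨hAc, hAJ⟩, hA₀⟩ := hmeets
  -- The imprisoning compact set is `A \ U`.
  refine himp ⟨A \ U, hAc.2 U hU, ?_⟩
  refine (ABoundary.tendsto_atEnd (fun k ↦ (ht k).2) htend).frequently (Eventually.frequently ?_)
  -- Since `t₀ < b`, the parameters `t k` eventually exceed `t₀`, after which the curve is trapped
  -- in `A`.
  filter_upwards [htend.eventually (lt_mem_nhds ht₀.2)] with k hk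
  exact ⟨hσ.mem_of_causalFuture_eq hAJ ht₀ hA₀ (ht k) (EReal.coe_lt_coe_iff.1 hk).le, hUσ k⟩
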